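/- Let $X$ be a non-empty compact metric space with metric $d$ and $f:X\to X$ a continuous map. For $x,y\in X$ and $\delta>0$ put $$\Phi_{x,y}(\delta)=\liminf_{n\to\infty}\frac1n\#\{0\le k\le n: d(f^k(x),f^k(y))<\delta\},\qquad \Phi^*_{x,y}(\delta)=\limsup_{n\to\infty}\frac1n\#\{0\le k\le n: d(f^k(x),f^k(y))<\delta\},$$ and let $\Phi_{x,y}(0)=\lim_{\delta\to0^+}\Phi_{x,y}(\delta)$, $\Phi^*_{x,y}(0)=\lim_{\delta\to0^+}\Phi^*_{x,y}(\delta)$. The pair $(x,y)$ is called - a DC$1$ pair if $\Phi^*_{x,y}(\delta)=1$ for every $0<\delta\le\operatorname{diam}X$ and $\Phi_{x,y}(\varepsilon)=0$ for some $0<\varepsilon\le\operatorname{diam}X$; - a DC$1.5$ pair if $\Phi^*_{x,y}(\delta)=1$ for every $0<\delta\le\operatorname{diam}X$ and $\Phi_{x,y}(0)=0$; - a DC$2$ pair if $\Phi^*_{x,y}(\delta)=1$ for every $0<\delta\le\operatorname{diam}X$ and $\Phi_{x,y}(\varepsilon)<1$ for some $0<\varepsilon\le\operatorname{diam}X$;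 - a DC$2.5$ pair if $\Phi_{x,y}(0)<\Phi^*_{x,y}(0)$; - a DC$3$ pair if there are $0\le a<b\le\operatorname{diam}X$ such that $\Phi_{x,y}(\delta)<\Phi^*_{x,y}(\delta)$ for every $\delta\in(a,b)$. A set $S\subseteq X$ is a DC$i$-scrambled set if every pair of distinct points of $S$ is a DC$i$ pair. A dendrite is a locally connected continuum (non-empty compact connected metric space) containing no subset homeomorphic to the circle. **Corollary.** For every $i\in\{1,1.5,2,2.5,3\}$ the existence of a DC$i$ pair does not imply the existence of an infinite DC$i$-scrambled set, even on dendrites: there are a dendrite $X$ and a continuous map $f:X\to X$ such that $f$ has a DC$i$ pair but no infinite DC$i$-scrambled set. -/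

import Mathlib

open Filter Topology

namespace DistChaos

/-- A metric space is a dendrite if it is a continuum (compact, connected, non-empty) which is
locally connected and contains no subset homeomorphic to the circle. -/
structure IsDendrite (X : Type*) [MetricSpace X] : Prop where
  compact : CompactSpace X
  connected : ConnectedSpace X
  locallyConnected : LocallyConnectedSpace X
  no_circle : ∀ S : Set X, ¬ Nonempty (S ≃ₜ Circle)

section

variable {X : Type*} [MetricSpace X]

open Classical in
/-- The number of `k` with `0 ≤ k ≤ n` and `d (f^k x) (f^k y) < δ`, divided by `n`. -/
noncomputable def closeFreq (f : X → X) (x y : X) (δ : ℝ) (n : ℕ) : ℝ :=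
  (((Finset.range (n + 1)).filter fun k => dist (f^[k] x) (f^[k] y) < δ).card : ℝ) / n

/-- The lower distribution function `Φ` of the pair `(x, y)`. -/
noncomputable def lowerDF (f : X → X) (x y : X) (δ : ℝ) : ℝ :=
  liminf (closeFreq f x y δ) atTop

/-- The upper distribution function `Φ*` of the pair `(x, y)`. -/
noncomputable def upperDF (f : X → X) (x y : X) (δ : ℝ) : ℝ :=
  limsup (closeFreq f x y δ) atTop

/-- `Φ* (δ) = 1` for all `0 < δ ≤ diam X`, and `Φ (ε) = 0` for some `0 < ε ≤ diam X`. -/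
def IsDC1Pair (f : X → X) (x y : X) : Prop :=
  (∀ δ, 0 < δ → δ ≤ Metric.diam (Set.univ : Set X) → upperDF f x y δ = 1) ∧
  ∃ ε, 0 < ε ∧ ε ≤ Metric.diam (Set.univ : Set X) ∧ lowerDF f x y ε = 0

/-- `Φ* (δ) = 1` for all `0 < δ ≤ diam X`, and `Φ (0) = 0`, where `Φ (0)` is the limit of `Φ`
at `0` from the right. -/
def IsDC1HalfPair (f : X → X) (x y : X) : Prop :=
  (∀ δ, 0 < δ → δ ≤ Metric.diam (Set.univ : Set X) → upperDF f x y δ = 1) ∧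
  Tendsto (lowerDF f x y) (𝓝[>] 0) (𝓝 0)

/-- `Φ* (δ) = 1` for all `0 < δ ≤ diam X`, and `Φ (ε) < 1` for some `0 < ε ≤ diam X`. -/
def IsDC2Pair (f : X → X) (x y : X) : Prop :=
  (∀ δ, 0 < δ → δ ≤ Metric.diam (Set.univ : Set X) → upperDF f x y δ = 1) ∧
  ∃ ε, 0 < ε ∧ ε ≤ Metric.diam (Set.univ : Set X) ∧ lowerDF f x y ε < 1

/-- `Φ (0) < Φ* (0)`, the values at `0` being the limits at `0` from the right. -/
def IsDC2HalfPair (f : X → X) (x y : X) : Prop :=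
  ∃ a b : ℝ, Tendsto (lowerDF f x y) (𝓝[>] 0) (𝓝 a) ∧
    Tendsto (upperDF f x y) (𝓝[>] 0) (𝓝 b) ∧ a < b

/-- `Φ (δ) < Φ* (δ)` for all `δ` in some interval `(a, b)` with `0 ≤ a < b ≤ diam X`. -/
def IsDC3Pair (f : X → X) (x y : X) : Prop :=
  ∃ a b : ℝ, 0 ≤ a ∧ a < b ∧ b ≤ Metric.diam (Set.univ : Set X) ∧
    ∀ δ ∈ Set.Ioo a b, lowerDF f x y δ < upperDF f x y δ

end

/-- The types `1`, `1½`, `2`, `2½`, `3` of distributional chaos. -/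
inductive DCType
  | one
  | oneHalf
  | two
  | twoHalf
  | three

/-- `(x, y)` is a DC`i` pair for `f`. -/
def IsDCPair {X : Type*} [MetricSpace X] (i : DCType) (f : X → X) (x y : X) : Prop :=
  match i with
  | .one => IsDC1Pair f x y
  | .oneHalf => IsDC1HalfPair f x y
  | .two => IsDC2Pair f x y
  | .twoHalf => IsDC2HalfPair f x y
  | .three => IsDC3Pair f x y

/-- `S` is a DC`i` set for `f`: every pair of distinct points of `S` is a DC`i` pair. -/
def IsDCSet {X : Type*} [MetricSpace X] (i : DCType) (f : X → X) (S : Set X) : Prop :=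
  ∀ x ∈ S, ∀ y ∈ S, x ≠ y → IsDCPair i f x y

end DistChaos

/-! Over an ultrametric space `K` of diameter at most 1, glue the segments over `a` and `b` at all
heights from `dist a b` on. The result is a tree with leaf set `K` and one root at height 1. If `K`
is compact and nonempty and has only countably many distances, it is a dendrite
(`UltraCone.isDendrite`): a point above a leaf at a height that is not a distance separates the
tree, while a circle minus a point is connected. A 2-Lipschitz self-map of `K` extends by doubling
heights, truncated at 1; every point that is not a leaf then reaches the root, so only the dynamics
on `K` matters.

Here `K` is the shift-orbit closure of one binary sequence, constant on blocks `[T, T ^ 2)` with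
alternating values, together with the zero sequence. Each block outweighs all earlier times, so this
sequence and zero form a DC1 pair (`TowerTree.isDC1Pair`), hence a pair of every type. Limits of
late shifts change value at most once, so each point of the tree reaches the root, or is a leaf that
is a shift of the sequence, eventually 0, or eventually 1. Jumps are sparse, so two points of the
same kind are close with frequency one (`TowerTree.tendsto_closeFreq_of_kind`) and form no DC pair.
An infinite set contains two points of the same kind. -/

/-! ### The cone over an ultrametric space, before gluing. -/

/-- A point of `K` with a height in `[0, 1]`. -/
structure PreCone (K : Type*) where
  base : K
  height : Set.Icc (0 : ℝ) 1

namespace PreCone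

/-- The set of points of the vertical segment over `p` from `p` up to height `m`. -/
def vert {K : Type*} (p : PreCone K) (m : ℝ) : Set (PreCone K) :=
  (fun s : Set.Icc (0 : ℝ) 1 => (⟨p.base, s⟩ : PreCone K)) '' {s | (p.height : ℝ) ≤ s ∧ (s : ℝ) ≤ m}

theorem self_mem_vert {K : Type*} {p : PreCone K} {m : ℝ} (h : (p.height : ℝ) ≤ m) : p ∈ vert p m :=
  ⟨p.height, ⟨le_rfl, h⟩, rfl⟩

section

variable {K : Type*} [MetricSpace K]

/-- The height of the geodesic joining two points. -/
noncomputable def join (p q : PreCone K) : ℝ := max (dist p.base q.base) (max p.height q.height)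

theorem join_comm (p q : PreCone K) : join p q = join q p := by
  unfold join
  rw [dist_comm, max_comm (p.height : ℝ)]

theorem left_le_join (p q : PreCone K) : (p.height : ℝ) ≤ join p q :=
  (le_max_left _ _).trans (le_max_right _ _)

theorem right_le_join (p q : PreCone K) : (q.height : ℝ) ≤ join p q :=
  (le_max_right _ _).trans (le_max_right _ _)

theorem dist_le_join (p q : PreCone K) : dist p.base q.base ≤ join p q := le_max_left _ _

end

variable {K : Type*} [MetricSpace K] [IsUltrametricDist K]

/-- This strong inequality yields the triangle inequality of the cone: the larger join dominates
`join p r`, and the other one is at least the height of `q`. -/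
theorem join_le_max (p q r : PreCone K) : join p r ≤ max (join p q) (join q r) := by
  refine max_le ?_ (max_le ?_ ?_)
  · exact (dist_triangle_max _ q.base _).trans (max_le_max (dist_le_join _ _) (dist_le_join _ _))
  · exact le_max_of_le_left (left_le_join _ _)
  · exact le_max_of_le_right (right_le_join _ _)

/-- Two points of an ultrametric space are glued at all heights above their distance;
the distance is the length of the geodesic in the resulting tree. -/
noncomputable instance : PseudoMetricSpace (PreCone K) where
  dist p q := 2 * join p q - p.height - q.height
  dist_self p := by
    have : join p p = p.height := by simp [join, p.height.2.1]
    rw [this]; ring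
  dist_comm p q := by rw [join_comm]; ring
  dist_triangle p q r := by
    have h1 := join_le_max p q r
    have h2 := right_le_join p q
    have h3 := left_le_join q r
    rcases le_max_iff.1 h1 with h | h <;> linarith

theorem dist_def (p q : PreCone K) : dist p q = 2 * join p q - p.height - q.height := rfl

instance [CompactSpace K] : CompactSpace (PreCone K) := by
  let g : K × Set.Icc (0 : ℝ) 1 → PreCone K := fun p => ⟨p.1, p.2⟩
  have hg : LipschitzWith 3 g := by
    refine LipschitzWith.of_dist_le_mul fun p q => ?_
    have h1 : dist p.1 q.1 ≤ dist p q := le_max_left _ _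
    have h2 : |(p.2 : ℝ) - q.2| ≤ dist p q := le_max_right _ _
    have h3 := abs_le.1 h2
    have h0 : 0 ≤ dist p.1 q.1 := dist_nonneg
    have h6 : (0 : ℝ) ≤ max (p.2 : ℝ) q.2 := le_max_of_le_left p.2.2.1
    have h4 : join (g p) (g q) ≤ dist p.1 q.1 + max (p.2 : ℝ) q.2 :=
      max_le (le_add_of_nonneg_right h6) (le_add_of_nonneg_left h0)
    have h5 : dist (g p) (g q) = 2 * join (g p) (g q) - p.2 - q.2 := rfl
    rw [h5, NNReal.coe_ofNat]
    rcases max_cases (p.2 : ℝ) q.2 with h | h <;> linarith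
  have hs : Function.Surjective g := fun p => ⟨(p.base, p.height), rfl⟩
  exact ⟨by rw [← hs.range_eq]; exact isCompact_range hg.continuous⟩

/-- The vertical segment over a point. -/
theorem continuous_vertical (e : K) : Continuous fun s : Set.Icc (0 : ℝ) 1 => (⟨e, s⟩ : PreCone K) := by
  refine (LipschitzWith.of_dist_le_mul (K := 1) fun s t => ?_).continuous
  have h : dist s t = |(s : ℝ) - t| := rfl
  have h1 : join (⟨e, s⟩ : PreCone K) ⟨e, t⟩ = max s t := by
    simp [join, s.2.1]
  rw [dist_def, h1, h]
  rcases max_cases (s : ℝ) t with h | h <;>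
    rcases abs_cases ((s : ℝ) - t) with h' | h' <;> push_cast <;> linarith

theorem isPreconnected_vert (p : PreCone K) (m : ℝ) : IsPreconnected (vert p m) := by
  refine IsPreconnected.image ?_ _ (continuous_vertical p.base).continuousOn
  refine Set.OrdConnected.isPreconnected ⟨fun a ha b hb c hc => ⟨?_, ?_⟩⟩
  · exact ha.1.trans hc.1
  · exact le_trans (Subtype.coe_le_coe.2 hc.2) hb.2

theorem dist_le_of_mem_vert_left {p q w : PreCone K} (hw : w ∈ vert p (join p q)) :
    dist w p ≤ dist p q := by
  obtain ⟨s, ⟨h1, h2⟩, rfl⟩ := hw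
  have h : join (⟨p.base, s⟩ : PreCone K) p = s := by
    simp [join, s.2.1, h1]
  rw [dist_def, dist_def, h]
  have := right_le_join p q
  simp only
  linarith

theorem dist_le_of_mem_vert_right {p q w : PreCone K} (hw : w ∈ vert q (join p q)) :
    dist w p ≤ dist p q := by
  obtain ⟨s, ⟨h1, h2⟩, rfl⟩ := hw
  have h : join (⟨q.base, s⟩ : PreCone K) p ≤ max (join p q) s := by
    rw [join_comm]
    refine max_le (le_max_of_le_left (dist_le_join p q)) (max_le ?_ (le_max_right (join p q) (s : ℝ)))
    exact le_max_of_le_left (left_le_join p q)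
  have h' : join (⟨q.base, s⟩ : PreCone K) p ≤ join p q := h.trans (max_le le_rfl h2)
  rw [dist_def, dist_def]
  simp only at h' ⊢
  linarith

/-- Points of the two vertical segments at the height of the join are glued. -/
theorem dist_eq_zero_of_join_le {a b : K} {s : Set.Icc (0 : ℝ) 1} (h : dist a b ≤ s) :
    dist (⟨a, s⟩ : PreCone K) ⟨b, s⟩ = 0 := by
  have : join (⟨a, s⟩ : PreCone K) ⟨b, s⟩ = s := by simp [join, h]
  rw [dist_def, this]; simp only; ring

/-- The height of the lowest point above both `p` and the leaf `e`. -/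
noncomputable def meet (e : K) (p : PreCone K) : ℝ := max (dist e p.base) p.height

theorem continuous_meet (e : K) : Continuous (meet e : PreCone K → ℝ) := by
  refine (LipschitzWith.of_le_add fun p q => ?_).continuous
  have h1 := left_le_join p q
  have h2 := right_le_join p q
  have h3 : (q.height : ℝ) ≤ meet e q := le_max_right _ _
  have h4 : dist e q.base ≤ meet e q := le_max_left _ _
  have h5 : dist e p.base ≤ max (dist e q.base) (join p q) := by
    refine (dist_triangle_max _ q.base _).trans (max_le_max le_rfl ?_)
    rw [dist_comm]; exact dist_le_join _ _
  have h6 : join p q ≤ meet e q + dist p q := by rw [dist_def]; linarith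
  refine max_le ?_ (h1.trans h6)
  rcases le_max_iff.1 h5 with h | h
  · exact (h.trans h4).trans (le_add_of_nonneg_right dist_nonneg)
  · exact h.trans h6

end PreCone

/-! ### The glued tree is a dendrite. -/

/-- The tree with leaf space `K`. -/
def UltraCone (K : Type*) [MetricSpace K] [IsUltrametricDist K] : Type _ :=
  SeparationQuotient (PreCone K)

namespace UltraCone

variable {K : Type*} [MetricSpace K] [IsUltrametricDist K]

noncomputable instance : MetricSpace (UltraCone K) :=
  inferInstanceAs (MetricSpace (SeparationQuotient (PreCone K)))

/-- The quotient map. -/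
noncomputable def mk (p : PreCone K) : UltraCone K := SeparationQuotient.mk p

theorem dist_mk (p q : PreCone K) : dist (mk p) (mk q) = dist p q := rfl

theorem continuous_mk : Continuous (mk : PreCone K → UltraCone K) := SeparationQuotient.continuous_mk

theorem surjective_mk : Function.Surjective (mk : PreCone K → UltraCone K) :=
  SeparationQuotient.surjective_mk

theorem mk_eq_mk {p q : PreCone K} : mk p = mk q ↔ dist p q = 0 := by
  rw [← dist_mk, dist_eq_zero]

instance [CompactSpace K] : CompactSpace (UltraCone K) :=
  ⟨by rw [← surjective_mk.range_eq]; exact isCompact_range continuous_mk⟩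

/-- The geodesic from `p` to `q`. -/
def geod (p q : PreCone K) : Set (UltraCone K) :=
  mk '' PreCone.vert p (PreCone.join p q) ∪ mk '' PreCone.vert q (PreCone.join p q)

theorem left_mem_geod (p q : PreCone K) : mk p ∈ geod p q :=
  Or.inl ⟨p, PreCone.self_mem_vert (PreCone.left_le_join _ _), rfl⟩

theorem right_mem_geod (p q : PreCone K) : mk q ∈ geod p q :=
  Or.inr ⟨q, PreCone.self_mem_vert (PreCone.right_le_join _ _), rfl⟩

/-- The two vertical segments meet at the height of the join; the diameter bound keeps that height
within `[0, 1]`. -/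
theorem isPreconnected_geod (hK : ∀ a b : K, dist a b ≤ 1) (p q : PreCone K) :
    IsPreconnected (geod p q) := by
  have h1 : PreCone.join p q ≤ 1 := max_le (hK _ _) (max_le p.height.2.2 q.height.2.2)
  let s : Set.Icc (0 : ℝ) 1 := ⟨PreCone.join p q, p.height.2.1.trans (PreCone.left_le_join _ _), h1⟩
  have e : mk (⟨p.base, s⟩ : PreCone K) = mk ⟨q.base, s⟩ :=
    mk_eq_mk.2 (PreCone.dist_eq_zero_of_join_le (PreCone.dist_le_join p q))
  refine IsPreconnected.union (mk (⟨p.base, s⟩ : PreCone K)) ?_ ?_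
    ((PreCone.isPreconnected_vert _ _).image _ continuous_mk.continuousOn)
    ((PreCone.isPreconnected_vert _ _).image _ continuous_mk.continuousOn)
  · exact ⟨_, ⟨s, ⟨PreCone.left_le_join p q, le_rfl⟩, rfl⟩, rfl⟩
  · rw [e]; exact ⟨_, ⟨s, ⟨PreCone.right_le_join p q, le_rfl⟩, rfl⟩, rfl⟩

theorem dist_le_of_mem_geod {p q : PreCone K} {w : UltraCone K} (hw : w ∈ geod p q) :
    dist w (mk p) ≤ dist (mk p) (mk q) := by
  rcases hw with ⟨v, hv, rfl⟩ | ⟨v, hv, rfl⟩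
  · exact PreCone.dist_le_of_mem_vert_left hv
  · exact PreCone.dist_le_of_mem_vert_right hv

/-- A geodesic from the centre never gets farther from it than its endpoint, so it stays in the
ball. -/
theorem isPreconnected_ball (hK : ∀ a b : K, dist a b ≤ 1) (x : UltraCone K) (r : ℝ) :
    IsPreconnected (Metric.ball x r) := by
  obtain ⟨p, rfl⟩ := surjective_mk x
  refine isPreconnected_of_forall (mk p) fun y hy => ?_
  obtain ⟨q, rfl⟩ := surjective_mk y
  refine ⟨geod p q, fun w hw => ?_, left_mem_geod p q, right_mem_geod p q,
    isPreconnected_geod hK p q⟩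
  rw [Metric.mem_ball, dist_comm] at hy
  exact (dist_le_of_mem_geod hw).trans_lt hy

theorem connectedSpace [Nonempty K] (hK : ∀ a b : K, dist a b ≤ 1) : ConnectedSpace (UltraCone K) where
  isPreconnected_univ := by
    obtain ⟨e⟩ := ‹Nonempty K›
    refine isPreconnected_of_forall (mk ⟨e, 1⟩) fun y _ => ?_
    obtain ⟨q, rfl⟩ := surjective_mk y
    exact ⟨_, Set.subset_univ _, left_mem_geod _ q, right_mem_geod _ q, isPreconnected_geod hK _ q⟩
  toNonempty := ⟨mk ⟨Classical.arbitrary K, 1⟩⟩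

theorem locallyConnectedSpace (hK : ∀ a b : K, dist a b ≤ 1) : LocallyConnectedSpace (UltraCone K) :=
  locallyConnectedSpace_of_connected_bases _ _ (fun _ => Metric.nhds_basis_ball)
    fun _ r _ => isPreconnected_ball hK _ r

/-- The continuous extension of `PreCone.meet` to the tree. -/
noncomputable def meet (e : K) : UltraCone K → ℝ :=
  SeparationQuotient.lift (PreCone.meet e) fun _ _ h => (h.map (PreCone.continuous_meet e)).eq

theorem meet_mk (e : K) (p : PreCone K) : meet e (mk p) = PreCone.meet e p := rfl

theorem continuous_meet (e : K) : Continuous (meet e : UltraCone K → ℝ) :=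
  SeparationQuotient.continuous_lift (PreCone.continuous_meet e)

/-- Some level of the function `meet` consists of a single point and separates `p` from `q`,
provided that `p` is not above `q`. -/
theorem exists_meet_level (hK : ∀ a b : K, dist a b ≤ 1) (hD : (Set.range fun p : K × K => dist p.1 p.2).Countable)
    {p q : PreCone K} (h : (p.height : ℝ) < PreCone.join p q) :
    ∃ s : ℝ, meet p.base (mk p) < s ∧ s < meet p.base (mk q) ∧
      ∃ z : UltraCone K, ∀ w, meet p.base w = s ↔ w = z := by
  -- An interval of heights is uncountable, so it contains some `s` that is not a distance of `K`.
  have hu : ¬ (Set.Ioo (p.height : ℝ) (PreCone.join p q)).Countable := by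
    rw [← Cardinal.le_aleph0_iff_set_countable, Cardinal.mk_Ioo_real h, not_le]
    exact Cardinal.aleph0_lt_continuum
  obtain ⟨s, ⟨hs1, hs2⟩, hs⟩ := Set.not_subset.1 fun hsub => hu (hD.mono hsub)
  have hq : PreCone.join p q ≤ max (p.height : ℝ) (PreCone.meet p.base q) :=
    max_le (le_max_of_le_right (le_max_left _ _))
      (max_le_max le_rfl (le_max_right _ _))
  have hq' : PreCone.join p q ≤ PreCone.meet p.base q := (le_max_iff.1 hq).resolve_left h.not_ge
  have hs1' : s ≤ 1 := hs2.le.trans (max_le (hK _ _) (max_le p.height.2.2 q.height.2.2))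
  refine ⟨s, ?_, hs2.trans_le hq', mk ⟨p.base, ⟨s, p.height.2.1.trans hs1.le, hs1'⟩⟩, fun w => ⟨fun hw => ?_, ?_⟩⟩
  · simpa [meet_mk, PreCone.meet, p.height.2.1] using hs1
  · obtain ⟨v, rfl⟩ := surjective_mk w
    rw [meet_mk] at hw
    -- As `s` is not a distance, the maximum defining `meet` is attained by the height; the point is
    -- then glued to the one above `p` at height `s`.
    have hne : dist p.base v.base ≠ s := fun h' => hs ⟨(p.base, v.base), h'⟩
    rcases max_choice (dist p.base v.base) (v.height : ℝ) with h' | h'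
    · exact absurd (h'.symm.trans hw) hne
    · have hv : (v.height : ℝ) = s := h'.symm.trans hw
      have hv' : dist v.base p.base ≤ v.height := by
        rw [dist_comm, hv, ← hw]; exact le_max_left _ _
      have := PreCone.dist_eq_zero_of_join_le hv'
      rw [mk_eq_mk]
      have hsv : (⟨s, p.height.2.1.trans hs1.le, hs1'⟩ : Set.Icc (0 : ℝ) 1) = v.height :=
        Subtype.ext hv.symm
      rw [hsv]
      exact this
  · rintro rfl
    simp [meet_mk, PreCone.meet, p.height.2.1.trans hs1.le]

/-- Removing a point disconnects every non-degenerate connected subset of the tree. -/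
theorem subsingleton_of_isPreconnected_diff_singleton (hK : ∀ a b : K, dist a b ≤ 1)
    (hD : (Set.range fun p : K × K => dist p.1 p.2).Countable) {S : Set (UltraCone K)}
    (hS : ∀ z, IsPreconnected (S \ {z})) : S.Subsingleton := by
  have key : ∀ p q : PreCone K, (p.height : ℝ) < PreCone.join p q → mk p ∈ S → mk q ∈ S → False := by
    intro p q h hp hq
    obtain ⟨s, h1, h2, z, hz⟩ := exists_meet_level hK hD h
    obtain ⟨w, hw, hws⟩ := (hS z).intermediate_value (f := meet p.base)
      ⟨hp, fun h => h1.ne ((hz _).2 h)⟩ ⟨hq, fun h => h2.ne' ((hz _).2 h)⟩ (continuous_meet _).continuousOn ⟨h1.le, h2.le⟩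
    exact hw.2 ((hz w).1 hws)
  intro x hx y hy
  by_contra hne
  obtain ⟨p, rfl⟩ := surjective_mk x
  obtain ⟨q, rfl⟩ := surjective_mk y
  have hpos : 0 < dist p q := lt_of_le_of_ne dist_nonneg fun h => hne (mk_eq_mk.2 h.symm)
  rw [PreCone.dist_def] at hpos
  -- If `p` lies at the join, it is above `q`; positivity of the distance then puts `q` strictly
  -- below, so the roles are exchanged.
  rcases (PreCone.left_le_join p q).lt_or_eq with h | h
  · exact key p q h hx hy
  · refine key q p ?_ hy hx
    rw [PreCone.join_comm]
    linarith

theorem isDendrite [CompactSpace K] [Nonempty K] (hK : ∀ a b : K, dist a b ≤ 1)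
    (hD : (Set.range fun p : K × K => dist p.1 p.2).Countable) :
    DistChaos.IsDendrite (UltraCone K) where
  compact := inferInstance
  connected := connectedSpace hK
  locallyConnected := locallyConnectedSpace hK
  no_circle := by
    rintro S ⟨φ⟩
    have hS : S.Subsingleton := by
      -- Deleting a point leaves the circle connected, whether or not that point lies on it.
      refine subsingleton_of_isPreconnected_diff_singleton hK hD fun z => ?_
      by_cases hz : z ∈ S
      · have h1 : IsPreconnected ({φ ⟨z, hz⟩}ᶜ : Set Circle) :=
          (Circle.isPathConnected_compl_singleton _).isConnected.isPreconnected
        have h2 := h1.image (fun c => (φ.symm c : UltraCone K))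
          (continuous_subtype_val.comp φ.symm.continuous).continuousOn
        convert h2 using 1
        ext w
        constructor
        · rintro ⟨hw, hwz⟩
          refine ⟨φ ⟨w, hw⟩, fun h => hwz ?_, by simp⟩
          exact congrArg Subtype.val (φ.injective h)
        · rintro ⟨c, hc, rfl⟩
          refine ⟨(φ.symm c).2, fun h => hc ?_⟩
          have : φ.symm c = ⟨z, hz⟩ := Subtype.ext h
          simp [← this]
      · rw [Set.sdiff_singleton_eq_self hz]
        have h2 := (isPreconnected_univ (α := Circle)).image (fun c => (φ.symm c : UltraCone K))
          (continuous_subtype_val.comp φ.symm.continuous).continuousOn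
        convert h2 using 1
        ext w
        constructor
        · intro hw
          exact ⟨φ ⟨w, hw⟩, trivial, by simp⟩
        · rintro ⟨c, -, rfl⟩
          exact (φ.symm c).2
    have h := hS (φ.symm 1).2 (φ.symm (-1)).2
    have h' : (1 : Circle) = -1 := φ.symm.injective (Subtype.ext h)
    have h'' := congrArg (fun c : Circle => (c : ℂ).re) h'
    norm_num at h''

end UltraCone

/-! ### Extending a map of the leaves to the tree. -/

/-- Doubling on the unit interval, truncated at `1`. -/
noncomputable def truncDouble (r : Set.Icc (0 : ℝ) 1) : Set.Icc (0 : ℝ) 1 :=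
  ⟨min 1 (2 * r), le_min zero_le_one (mul_nonneg zero_le_two r.2.1), min_le_left _ _⟩

theorem truncDouble_zero : truncDouble 0 = 0 := Subtype.ext (by simp [truncDouble])

theorem coe_iterate_truncDouble (r : Set.Icc (0 : ℝ) 1) (n : ℕ) :
    (truncDouble^[n] r : ℝ) = min 1 (2 ^ n * (r : ℝ)) := by
  induction n with
  | zero => simp [r.2.2]
  | succ n ih =>
    rw [Function.iterate_succ_apply']
    change min 1 (2 * (truncDouble^[n] r : ℝ)) = _
    rw [ih, pow_succ']
    rcases min_cases (1 : ℝ) (2 ^ n * (r : ℝ)) with h | h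
    · rw [h.1, min_eq_left (by norm_num), min_eq_left (by linarith [h.2])]
    · rw [h.1, mul_assoc]

theorem exists_iterate_truncDouble_eq_one {r : Set.Icc (0 : ℝ) 1} (hr : r ≠ 0) :
    ∃ N, ∀ n ≥ N, truncDouble^[n] r = 1 := by
  have hr' : (0 : ℝ) < r := lt_of_le_of_ne r.2.1 fun h => hr (Subtype.ext h.symm)
  obtain ⟨N, hN⟩ := pow_unbounded_of_one_lt (r : ℝ)⁻¹ one_lt_two
  refine ⟨N, fun n hn => Subtype.ext ?_⟩
  rw [coe_iterate_truncDouble]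
  refine min_eq_left ?_
  refine (inv_mul_cancel₀ hr'.ne').symm.trans_le ?_
  exact mul_le_mul_of_nonneg_right (hN.le.trans (pow_le_pow_right₀ one_le_two hn)) hr'.le

namespace PreCone

variable {K : Type*}

/-- The map acting by `f` on base points and doubling the heights. -/
noncomputable def map (f : K → K) (p : PreCone K) : PreCone K := ⟨f p.base, truncDouble p.height⟩

theorem iterate_map (f : K → K) (p : PreCone K) (n : ℕ) :
    (map f)^[n] p = ⟨f^[n] p.base, truncDouble^[n] p.height⟩ := by
  induction n with
  | zero => rfl
  | succ n ih => simp only [Function.iterate_succ_apply', ih, map]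

/-- The distance is the sum of the two climbs from the heights to the join, and truncated doubling
stretches each climb by at most 2. -/
theorem lipschitzWith_map [MetricSpace K] [IsUltrametricDist K] (hK : ∀ a b : K, dist a b ≤ 1)
    {f : K → K} (hf : LipschitzWith 2 f) :
    LipschitzWith 2 (map f) := by
  refine LipschitzWith.of_dist_le_mul fun p q => ?_
  have h1 : dist (f p.base) (f q.base) ≤ 2 * join p q :=
    (hf.dist_le_mul _ _).trans (mul_le_mul_of_nonneg_left (dist_le_join p q) zero_le_two)
  have h2 := left_le_join p q
  have h3 := right_le_join p q
  have h4 : join (map f p) (map f q) ≤ min 1 (2 * join p q) := by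
    refine max_le (le_min (hK _ _) h1) (max_le ?_ ?_)
    · exact min_le_min le_rfl (by linarith)
    · exact min_le_min le_rfl (by linarith)
  have e1 : ((map f p).height : ℝ) = min 1 (2 * (p.height : ℝ)) := rfl
  have e2 : ((map f q).height : ℝ) = min 1 (2 * (q.height : ℝ)) := rfl
  rw [dist_def, dist_def, e1, e2, NNReal.coe_ofNat]
  rcases min_cases (1 : ℝ) (2 * join p q) with h | h <;>
  rcases min_cases (1 : ℝ) (2 * (p.height : ℝ)) with h' | h' <;>
  rcases min_cases (1 : ℝ) (2 * q.height) with h'' | h'' <;>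
  rw [h'.1, h''.1] <;> linarith

end PreCone

namespace UltraCone

variable {K : Type*} [MetricSpace K] [IsUltrametricDist K]

/-- The map of the tree acting by `f` on leaves and doubling the heights. -/
noncomputable def map (hK : ∀ a b : K, dist a b ≤ 1) {f : K → K} (hf : LipschitzWith 2 f) :
    UltraCone K → UltraCone K :=
  SeparationQuotient.lift (mk ∘ PreCone.map f) fun _ _ h =>
    (h.map (continuous_mk.comp (PreCone.lipschitzWith_map hK hf).continuous)).eq

variable (hK : ∀ a b : K, dist a b ≤ 1) {f : K → K} (hf : LipschitzWith 2 f)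

theorem continuous_map : Continuous (map hK hf) :=
  SeparationQuotient.continuous_lift
    (continuous_mk.comp (PreCone.lipschitzWith_map hK hf).continuous)

theorem iterate_map_mk (p : PreCone K) (n : ℕ) :
    (map hK hf)^[n] (mk p) = mk ⟨f^[n] p.base, truncDouble^[n] p.height⟩ := by
  rw [← PreCone.iterate_map]
  have h : Function.Semiconj mk (PreCone.map f) (map hK hf) := fun _ => rfl
  exact ((h.iterate_right n).eq p).symm

/-- The leaf of the tree given by a point of `K`. -/
noncomputable def leaf (a : K) : UltraCone K := mk ⟨a, 0⟩

theorem dist_leaf (a b : K) : dist (leaf a) (leaf b) = 2 * dist a b := by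
  have : PreCone.join (⟨a, 0⟩ : PreCone K) ⟨b, 0⟩ = dist a b := by simp [PreCone.join]
  rw [leaf, leaf, dist_mk, PreCone.dist_def, this]
  simp

theorem iterate_map_leaf (a : K) (n : ℕ) : (map hK hf)^[n] (leaf a) = leaf (f^[n] a) := by
  rw [leaf, iterate_map_mk, Function.iterate_fixed truncDouble_zero]; rfl

theorem mk_one_eq_mk_one (hK : ∀ a b : K, dist a b ≤ 1) (a b : K) : mk (⟨a, 1⟩ : PreCone K) = mk ⟨b, 1⟩ :=
  mk_eq_mk.2 (PreCone.dist_eq_zero_of_join_le (hK a b))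

/-- A point that is not a leaf reaches the root after finitely many steps. -/
theorem eq_leaf_or_eventually_root (c : K) (x : UltraCone K) :
    (∃ a, x = leaf a) ∨ ∃ N, ∀ n ≥ N, (map hK hf)^[n] x = mk ⟨c, 1⟩ := by
  obtain ⟨p, rfl⟩ := surjective_mk x
  by_cases hp : p.height = 0
  · exact Or.inl ⟨p.base, by rw [leaf, ← hp]⟩
  · obtain ⟨N, hN⟩ := exists_iterate_truncDouble_eq_one hp
    refine Or.inr ⟨N, fun n hn => ?_⟩
    rw [iterate_map_mk, hN n hn, mk_one_eq_mk_one hK _ c]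

end UltraCone

/-! ### Distribution functions and DC pairs. -/

namespace DistChaos

variable {X : Type*} [MetricSpace X] {f : X → X} {x y : X} {δ : ℝ}

theorem closeFreq_nonneg (n : ℕ) : 0 ≤ closeFreq f x y δ n := by
  unfold closeFreq; positivity

/-- There are `n + 1` times but the divisor is `n`, so frequencies may exceed 1; only their limits
are bounded by 1. -/
theorem closeFreq_le (n : ℕ) : closeFreq f x y δ n ≤ (n + 1) / n := by
  classical
  unfold closeFreq
  refine div_le_div_of_nonneg_right ?_ n.cast_nonneg
  exact_mod_cast (Finset.card_filter_le _ _).trans_eq (Finset.card_range _)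

theorem tendsto_succ_div_self : Tendsto (fun n : ℕ => ((n : ℝ) + 1) / n) atTop (𝓝 1) := by
  have h : Tendsto (fun n : ℕ => 1 + (n : ℝ)⁻¹) atTop (𝓝 1) := by
    simpa using (tendsto_inv_atTop_nhds_zero_nat (𝕜 := ℝ)).const_add 1
  refine h.congr' ?_
  filter_upwards [eventually_gt_atTop 0] with n hn
  have : (n : ℝ) ≠ 0 := by positivity
  field_simp

theorem isBoundedUnder_le_closeFreq : IsBoundedUnder (· ≤ ·) atTop (closeFreq f x y δ) :=
  (tendsto_succ_div_self.isBoundedUnder_le).mono_le (Eventually.of_forall closeFreq_le)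

theorem isBoundedUnder_ge_closeFreq : IsBoundedUnder (· ≥ ·) atTop (closeFreq f x y δ) :=
  isBoundedUnder_of ⟨0, closeFreq_nonneg⟩

theorem closeFreq_mono {δ' : ℝ} (h : δ ≤ δ') (n : ℕ) : closeFreq f x y δ n ≤ closeFreq f x y δ' n := by
  classical
  unfold closeFreq
  gcongr

theorem lowerDF_nonneg : 0 ≤ lowerDF f x y δ :=
  le_liminf_of_le isBoundedUnder_le_closeFreq.isCoboundedUnder_ge
    (Eventually.of_forall closeFreq_nonneg)

theorem lowerDF_mono {δ' : ℝ} (h : δ ≤ δ') : lowerDF f x y δ ≤ lowerDF f x y δ' :=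
  liminf_le_liminf (Eventually.of_forall (closeFreq_mono h)) isBoundedUnder_ge_closeFreq
    isBoundedUnder_le_closeFreq.isCoboundedUnder_ge

theorem upperDF_le_one : upperDF f x y δ ≤ 1 := by
  rw [← tendsto_succ_div_self.limsup_eq]
  exact limsup_le_limsup (Eventually.of_forall closeFreq_le)
    isBoundedUnder_ge_closeFreq.isCoboundedUnder_le tendsto_succ_div_self.isBoundedUnder_le

/-- DC1 is the strongest type: by monotonicity the lower function vanishes on all of `(0, ε]`, where
the upper one equals 1. -/
theorem IsDC1Pair.isDCPair (h : IsDC1Pair f x y) (i : DCType) : IsDCPair i f x y := by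
  obtain ⟨h1, ε, hε, hεd, h2⟩ := h
  have h3 : ∀ δ ≤ ε, lowerDF f x y δ = 0 := fun δ hδ =>
    le_antisymm ((lowerDF_mono hδ).trans_eq h2) lowerDF_nonneg
  have h4 : Tendsto (lowerDF f x y) (𝓝[>] 0) (𝓝 0) := by
    refine tendsto_const_nhds.congr' ?_
    filter_upwards [Ioo_mem_nhdsGT hε] with δ hδ using (h3 δ hδ.2.le).symm
  match i with
  | .one => exact ⟨h1, ε, hε, hεd, h2⟩
  | .oneHalf => exact ⟨h1, h4⟩
  | .two => exact ⟨h1, ε, hε, hεd, h2.trans_lt one_pos⟩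
  | .twoHalf =>
    refine ⟨0, 1, h4, tendsto_const_nhds.congr' ?_, one_pos⟩
    filter_upwards [Ioo_mem_nhdsGT hε] with δ hδ using (h1 δ hδ.1 (hδ.2.le.trans hεd)).symm
  | .three =>
    refine ⟨0, ε, le_rfl, hε, hεd, fun δ hδ => ?_⟩
    rw [h3 δ hδ.2.le, h1 δ hδ.1 (hδ.2.le.trans hεd)]
    exact one_pos

theorem not_isDCPair_of_tendsto (h : ∀ δ > 0, Tendsto (closeFreq f x y δ) atTop (𝓝 1))
    (i : DCType) : ¬ IsDCPair i f x y := by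
  have hl : ∀ δ > 0, lowerDF f x y δ = 1 := fun δ hδ => (h δ hδ).liminf_eq
  have hu : ∀ δ > 0, upperDF f x y δ = 1 := fun δ hδ => (h δ hδ).limsup_eq
  have hl' : Tendsto (lowerDF f x y) (𝓝[>] 0) (𝓝 1) := by
    refine tendsto_const_nhds.congr' ?_
    filter_upwards [self_mem_nhdsWithin] with δ hδ using (hl δ hδ).symm
  have hu' : Tendsto (upperDF f x y) (𝓝[>] 0) (𝓝 1) := by
    refine tendsto_const_nhds.congr' ?_
    filter_upwards [self_mem_nhdsWithin] with δ hδ using (hu δ hδ).symm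
  match i with
  | .one =>
    rintro ⟨-, ε, hε, -, h0⟩
    exact one_ne_zero ((hl ε hε).symm.trans h0)
  | .oneHalf =>
    rintro ⟨-, h0⟩
    exact one_ne_zero (tendsto_nhds_unique hl' h0)
  | .two =>
    rintro ⟨-, ε, hε, -, h0⟩
    exact h0.ne (hl ε hε)
  | .twoHalf =>
    rintro ⟨a, b, ha, hb, hab⟩
    exact hab.ne ((tendsto_nhds_unique ha hl').trans (tendsto_nhds_unique hb hu').symm)
  | .three =>
    rintro ⟨a, b, ha, hab, -, h0⟩
    have hm : (a + b) / 2 ∈ Set.Ioo a b := ⟨by linarith, by linarith⟩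
    have hm0 : 0 < (a + b) / 2 := by linarith
    exact (h0 _ hm).ne ((hl _ hm0).trans (hu _ hm0).symm)

/-- If the times at which the orbits are `δ`-apart are rare along `φ`, then the frequencies of
`δ`-closeness tend to `1` along `φ`. -/
theorem tendsto_closeFreq_one {φ : ℕ → ℕ} (hφ : Tendsto φ atTop atTop) (B : ℕ → Finset ℕ)
    (hB : ∀ j, ∀ k ≤ φ j, δ ≤ dist (f^[k] x) (f^[k] y) → k ∈ B j)
    (h0 : Tendsto (fun j => ((B j).card : ℝ) / φ j) atTop (𝓝 0)) :
    Tendsto (fun j => closeFreq f x y δ (φ j)) atTop (𝓝 1) := by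
  classical
  have h1 := tendsto_succ_div_self.comp hφ
  have h2 := h1.sub h0
  rw [sub_zero] at h2
  refine tendsto_of_tendsto_of_tendsto_of_le_of_le h2 h1 (fun j => ?_) (fun j => closeFreq_le _)
  simp only [Function.comp, closeFreq]
  rw [← sub_div]
  refine div_le_div_of_nonneg_right ?_ (Nat.cast_nonneg _)
  rw [sub_le_iff_le_add]
  have h3 : Finset.range (φ j + 1) ⊆
      (Finset.range (φ j + 1)).filter (fun k => dist (f^[k] x) (f^[k] y) < δ) ∪ B j := by
    intro k hk
    by_cases h : dist (f^[k] x) (f^[k] y) < δ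
    · exact Finset.mem_union_left _ (Finset.mem_filter.2 ⟨hk, h⟩)
    · exact Finset.mem_union_right _ (hB j k (Finset.mem_range_succ_iff.1 hk) (not_lt.1 h))
  have h4 := (Finset.card_le_card h3).trans (Finset.card_union_le _ _)
  rw [Finset.card_range] at h4
  convert (Nat.cast_le (α := ℝ)).2 h4 using 1 <;> push_cast <;> rfl

/-- If the times at which the orbits are `δ`-close are rare along `φ`, then the frequencies of
`δ`-closeness tend to `0` along `φ`. -/
theorem tendsto_closeFreq_zero {φ : ℕ → ℕ} (B : ℕ → Finset ℕ)
    (hB : ∀ j, ∀ k ≤ φ j, dist (f^[k] x) (f^[k] y) < δ → k ∈ B j)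
    (h0 : Tendsto (fun j => ((B j).card : ℝ) / φ j) atTop (𝓝 0)) :
    Tendsto (fun j => closeFreq f x y δ (φ j)) atTop (𝓝 0) := by
  classical
  refine squeeze_zero (fun j => closeFreq_nonneg _) (fun j => ?_) h0
  unfold closeFreq
  refine div_le_div_of_nonneg_right ?_ (Nat.cast_nonneg _)
  refine Nat.cast_le.2 (Finset.card_le_card fun k hk => ?_)
  rw [Finset.mem_filter] at hk
  exact hB j k (Finset.mem_range_succ_iff.1 hk.1) hk.2

theorem tendsto_closeFreq_of_eventually_eq {N : ℕ} (h : ∀ n ≥ N, f^[n] x = f^[n] y) (hδ : 0 < δ) :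
    Tendsto (closeFreq f x y δ) atTop (𝓝 1) := by
  refine tendsto_closeFreq_one (φ := id) tendsto_id (fun _ => Finset.range N) (fun j k _ hk => ?_)
    (tendsto_const_div_atTop_nhds_zero_nat _)
  rw [Finset.mem_range]
  by_contra! hc
  rw [h k hc, dist_self] at hk
  exact hδ.not_ge hk

theorem upperDF_eq_one {φ : ℕ → ℕ} (hφ : Tendsto φ atTop atTop)
    (h : Tendsto (fun j => closeFreq f x y δ (φ j)) atTop (𝓝 1)) : upperDF f x y δ = 1 := by
  refine le_antisymm upperDF_le_one ?_
  have h' : Tendsto (closeFreq f x y δ) (map φ atTop) (𝓝 1) := tendsto_map'_iff.2 h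
  rw [← h'.limsup_eq]
  exact limsup_le_limsup_of_le hφ h'.isBoundedUnder_ge.isCoboundedUnder_le isBoundedUnder_le_closeFreq

theorem lowerDF_eq_zero {φ : ℕ → ℕ} (hφ : Tendsto φ atTop atTop)
    (h : Tendsto (fun j => closeFreq f x y δ (φ j)) atTop (𝓝 0)) : lowerDF f x y δ = 0 := by
  refine le_antisymm ?_ lowerDF_nonneg
  have h' : Tendsto (closeFreq f x y δ) (map φ atTop) (𝓝 0) := tendsto_map'_iff.2 h
  rw [← h'.liminf_eq]
  exact liminf_le_liminf_of_le hφ isBoundedUnder_ge_closeFreq h'.isBoundedUnder_le.isCoboundedUnder_ge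

end DistChaos

/-! ### The block sequence and the sparsity of its jumps. -/

/-- The sequence that is constant on the blocks `[2 ^ 2 ^ k, 2 ^ 2 ^ (k + 1))`, with alternating
values. -/
def towerSeq (n : ℕ) : Bool := decide (Even (Nat.log 2 (Nat.log 2 n)))

theorem log_log_eq {k n : ℕ} (h1 : 2 ^ 2 ^ k ≤ n) (h2 : n < 2 ^ 2 ^ (k + 1)) :
    Nat.log 2 (Nat.log 2 n) = k := by
  have hn : n ≠ 0 := (lt_of_lt_of_le (by positivity) h1).ne'
  exact Nat.log_eq_of_pow_le_of_lt_pow (Nat.le_log_of_pow_le one_lt_two h1)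
    (Nat.log_lt_of_lt_pow hn h2)

/-- The iterated logarithm is monotone, so a change of parity means that it increases, which happens
only on reaching a tower. -/
theorem eq_tower_of_towerSeq_ne {n : ℕ} (h : towerSeq n ≠ towerSeq (n + 1)) :
    ∃ k, n + 1 = 2 ^ 2 ^ k := by
  set k := Nat.log 2 (Nat.log 2 (n + 1)) with hk
  have hne : Nat.log 2 (Nat.log 2 n) ≠ k := fun h' => h (by simp only [towerSeq, h', ← hk])
  have hle : Nat.log 2 (Nat.log 2 n) ≤ k := Nat.log_mono_right (Nat.log_mono_right n.le_succ)
  have hlt : Nat.log 2 (Nat.log 2 n) < k := lt_of_le_of_ne hle hne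
  have hl : Nat.log 2 (n + 1) ≠ 0 := by
    intro h0
    rw [hk, h0] at hlt
    simp at hlt
  refine ⟨k, le_antisymm ?_ ?_⟩
  · have h1 := Nat.lt_pow_of_log_lt one_lt_two hlt
    exact Nat.lt_pow_of_log_lt one_lt_two h1
  · exact Nat.pow_le_of_le_log n.succ_ne_zero (Nat.pow_le_of_le_log hl le_rfl)

theorem tower_succ (k : ℕ) : 2 ^ 2 ^ (k + 1) = (2 ^ 2 ^ k) ^ 2 := by
  rw [← pow_mul, pow_succ]

/-- Two distinct powers `2 ^ 2 ^ k` are far from each other. -/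
theorem two_mul_tower_le {k l : ℕ} (h : k < l) : 2 * 2 ^ 2 ^ k ≤ 2 ^ 2 ^ l := by
  have h1 : 2 ^ k + 1 ≤ 2 ^ l := Nat.pow_lt_pow_right one_lt_two h
  calc 2 * 2 ^ 2 ^ k = 2 ^ (2 ^ k + 1) := by rw [pow_succ, mul_comm]
    _ ≤ 2 ^ 2 ^ l := Nat.pow_le_pow_right two_pos h1

theorem towerSeq_eq {k n : ℕ} (h1 : 2 ^ 2 ^ k ≤ n) (h2 : n < (2 ^ 2 ^ k) ^ 2) :
    towerSeq n = decide (Even k) := by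
  rw [towerSeq, log_log_eq h1 (h2.trans_eq (tower_succ k).symm)]

/-- A crude bound that suffices for sparsity: at most `√m + 1` indices `l` have their tower at or
below `m`. -/
theorem sq_le_tower (l : ℕ) : l ^ 2 ≤ 2 ^ 2 ^ l := by
  rcases l with _ | l
  · simp
  · rw [tower_succ]
    exact Nat.pow_le_pow_left (Nat.lt_two_pow_self.trans_le
      (Nat.pow_le_pow_right two_pos Nat.lt_two_pow_self.le)) 2

/-- A sequence that takes two different values between `a` and `b` changes in between. -/
theorem exists_ne_succ {α : Type*} {s : ℕ → α} {a b : ℕ} (hab : a ≤ b) (h : s a ≠ s b) :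
    ∃ t, a ≤ t ∧ t < b ∧ s t ≠ s (t + 1) := by
  by_contra! hc
  refine h ?_
  induction b, hab using Nat.le_induction with
  | base => rfl
  | succ b hb ih =>
    by_cases hs : s a = s b
    · exact hs.trans (hc b hb b.lt_succ_self)
    · exact absurd (ih hs fun t h1 h2 => hc t h1 (h2.trans b.lt_succ_self)) hs

/-- The times at most `n` whose window of length `L` meets some `2 ^ 2 ^ l`. -/
def towerWindow (L n : ℕ) : Finset ℕ :=
  (Finset.range (Nat.sqrt (n + L) + 1) ×ˢ Finset.range (L + 1)).image fun p => 2 ^ 2 ^ p.1 - p.2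

theorem mem_towerWindow {L n k l : ℕ} (hk : k ≤ n) (h1 : k ≤ 2 ^ 2 ^ l) (h2 : 2 ^ 2 ^ l ≤ k + L) :
    k ∈ towerWindow L n := by
  refine Finset.mem_image.2 ⟨(l, 2 ^ 2 ^ l - k), Finset.mem_product.2 ⟨?_, ?_⟩, ?_⟩
  · rw [Finset.mem_range_succ_iff, Nat.le_sqrt']
    exact (sq_le_tower l).trans (h2.trans (by omega))
  · rw [Finset.mem_range_succ_iff]; simp only; omega
  · simp only; omega

theorem tendsto_card_towerWindow (L : ℕ) :
    Tendsto (fun n => ((towerWindow L n).card : ℝ) / n) atTop (𝓝 0) := by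
  have h1 : Tendsto (fun n : ℕ => (2 * (√(n : ℝ))⁻¹ + (n : ℝ)⁻¹) * (L + 1)) atTop (𝓝 0) := by
    have h2 : Tendsto (fun n : ℕ => (√(n : ℝ))⁻¹) atTop (𝓝 0) :=
      tendsto_inv_atTop_zero.comp (Real.tendsto_sqrt_atTop.comp tendsto_natCast_atTop_atTop)
    simpa using ((h2.const_mul 2).add
      (tendsto_inv_atTop_nhds_zero_nat (𝕜 := ℝ))).mul_const ((L : ℝ) + 1)
  refine squeeze_zero' (Eventually.of_forall fun n => by positivity) ?_ h1
  filter_upwards [eventually_gt_atTop L] with n hn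
  have hn0 : (0 : ℝ) < n := Nat.cast_pos.2 (by omega)
  have h3 : (towerWindow L n).card ≤ (Nat.sqrt (n + L) + 1) * (L + 1) := by
    refine Finset.card_image_le.trans ?_
    rw [Finset.card_product, Finset.card_range, Finset.card_range]
  have h4 : (Nat.sqrt (n + L) : ℝ) ≤ 2 * √(n : ℝ) := by
    refine Real.nat_sqrt_le_real_sqrt.trans (Real.sqrt_le_iff.2 ⟨by positivity, ?_⟩)
    rw [mul_pow, Real.sq_sqrt hn0.le]
    have : (L : ℝ) ≤ n := Nat.cast_le.2 hn.le
    push_cast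
    linarith
  have h5 : ((towerWindow L n).card : ℝ) ≤ (2 * √(n : ℝ) + 1) * (L + 1) := by
    refine (Nat.cast_le.2 h3).trans ?_
    push_cast
    gcongr
  rw [div_le_iff₀ hn0]
  refine h5.trans_eq ?_
  have h6 : √(n : ℝ) * √(n : ℝ) = n := Real.mul_self_sqrt hn0.le
  have h7 : √(n : ℝ) ≠ 0 := (Real.sqrt_pos.2 hn0).ne'
  have h8 : (√(n : ℝ))⁻¹ * n = √(n : ℝ) := by rw [inv_mul_eq_iff_eq_mul₀ h7, h6]
  have h9 : (n : ℝ)⁻¹ * n = 1 := inv_mul_cancel₀ hn0.ne'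
  linear_combination (-2 * ((L : ℝ) + 1)) * h8 - ((L : ℝ) + 1) * h9

/-- At the end `T ^ 2` of a block starting at `T`, the exceptional times are the `T` earlier ones
and boundedly many near the end. -/
theorem tendsto_add_div_sq (c : ℕ) :
    Tendsto (fun T : ℕ => ((T + c : ℕ) : ℝ) / (T ^ 2 : ℕ)) atTop (𝓝 0) := by
  have h := tendsto_inv_atTop_nhds_zero_nat (𝕜 := ℝ)
  have h2 : Tendsto (fun T : ℕ => (T : ℝ)⁻¹ + c * ((T : ℝ)⁻¹) ^ 2) atTop (𝓝 0) := by
    simpa using h.add ((h.pow 2).const_mul (c : ℝ))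
  refine h2.congr' ?_
  filter_upwards [eventually_gt_atTop 0] with T hT
  have : (T : ℝ) ≠ 0 := by positivity
  push_cast
  field_simp

theorem tendsto_tower : Tendsto (fun k => 2 ^ 2 ^ k) atTop (atTop : Filter ℕ) :=
  tendsto_atTop_mono (fun _ => (Nat.lt_two_pow_self.le.trans
    (Nat.pow_le_pow_right two_pos Nat.lt_two_pow_self.le))) tendsto_id

/-! ### The orbit closure in the full binary shift. -/

namespace BinSeq

attribute [local instance] PiNat.metricSpace

instance : IsUltrametricDist (ℕ → Bool) := ⟨PiNat.dist_triangle_nonarch⟩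

/-- The shift map on binary sequences. -/
def shift (s : ℕ → Bool) : ℕ → Bool := fun n => s (n + 1)

theorem iterate_shift (s : ℕ → Bool) (n k : ℕ) : shift^[n] s k = s (k + n) := by
  induction n generalizing k with
  | zero => rfl
  | succ n ih =>
    rw [Function.iterate_succ_apply', shift, ih, add_right_comm, add_assoc]

theorem dist_le_iff {s t : ℕ → Bool} {n : ℕ} : dist s t ≤ (1 / 2) ^ n ↔ ∀ i < n, s i = t i := by
  rw [← PiNat.mem_cylinder_iff_dist_le, PiNat.mem_cylinder_iff]

theorem lipschitzWith_shift : LipschitzWith 2 shift := by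
  refine LipschitzWith.of_dist_le_mul fun s t => ?_
  rw [NNReal.coe_ofNat]
  by_cases h : s = t
  · simp [h]
  have hd := PiNat.dist_eq_of_ne h
  have hc := dist_le_iff.1 hd.le
  rw [hd]
  generalize PiNat.firstDiff s t = d at hc
  rcases d with _ | m
  · exact (PiNat.dist_le_one _ _).trans (by norm_num)
  · rw [pow_succ, mul_comm, mul_assoc, one_div_mul_cancel two_ne_zero, mul_one]
    refine dist_le_iff.2 fun i hi => hc _ ?_
    omega

/-- Provides the countability that makes the tree over any set of binary sequences free of circles.
-/
theorem countable_range_dist (S : Set (ℕ → Bool)) :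
    (Set.range fun p : S × S => dist p.1 p.2).Countable := by
  refine ((Set.countable_range fun n : ℕ => (1 / 2 : ℝ) ^ n).insert 0).mono ?_
  rintro _ ⟨⟨s, t⟩, rfl⟩
  by_cases h : (s : ℕ → Bool) = t
  · exact Or.inl (by simp [Subtype.ext h])
  · exact Or.inr ⟨_, (PiNat.dist_eq_of_ne h).symm⟩

/-- The closure of the orbit of `towerSeq`, together with the zero sequence. -/
def towerShift : Set (ℕ → Bool) :=
  insert (fun _ => false) (closure (Set.range fun n => shift^[n] towerSeq))

theorem isCompact_towerShift : IsCompact towerShift :=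
  isClosed_closure.isCompact.insert _

theorem mapsTo_shift : Set.MapsTo shift towerShift towerShift := by
  rintro s (rfl | hs)
  · exact Or.inl rfl
  · refine Or.inr (Set.MapsTo.closure ?_ lipschitzWith_shift.continuous hs)
    rintro _ ⟨n, rfl⟩
    exact ⟨n + 1, Function.iterate_succ_apply' _ _ _⟩

/-- A limit of the orbit of `towerSeq` changes its value at most once. -/
theorem le_of_mem_closure_tails {s : ℕ → Bool}
    (hs : ∀ m, s ∈ closure ((fun n => shift^[n] towerSeq) '' Set.Ici m)) {i j : ℕ}
    (hi : s i ≠ s (i + 1)) (hj : s j ≠ s (j + 1)) : j ≤ i := by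
  by_contra! hij
  -- Taking the tail from `j` on forces `j ≤ n`, so the two jumps would be towers `n + i + 1 < n + j
  -- + 1` of ratio below 2. The radius secures agreement up to coordinate `j + 1`.
  obtain ⟨_, ⟨n, hn, rfl⟩, hd⟩ := Metric.mem_closure_iff.1 (hs j) ((1 / 2) ^ (j + 2)) (by positivity)
  have heq : ∀ k < j + 2, s k = towerSeq (k + n) := fun k hk => by
    rw [dist_le_iff.1 hd.le k hk]; exact iterate_shift _ _ _
  rw [Set.mem_Ici] at hn
  rw [heq i (by omega), heq (i + 1) (by omega), add_right_comm] at hi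
  rw [heq j (by omega), heq (j + 1) (by omega), add_right_comm] at hj
  obtain ⟨k, hk⟩ := eq_tower_of_towerSeq_ne hi
  obtain ⟨l, hl⟩ := eq_tower_of_towerSeq_ne hj
  have hkl : k < l := by
    by_contra! hc
    have : 2 ^ 2 ^ l ≤ 2 ^ 2 ^ k := Nat.pow_le_pow_right two_pos (Nat.pow_le_pow_right two_pos hc)
    omega
  have := two_mul_tower_le hkl
  omega

/-- A point in the closure of every tail of the orbit has at most one jump; any other orbit-closure
point lies in the closure of a finite piece, which is closed. -/
theorem eventually_const_or_eq_iterate {s : ℕ → Bool} (hs : s ∈ towerShift) :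
    (∃ b N, ∀ n ≥ N, s n = b) ∨ ∃ m, s = shift^[m] towerSeq := by
  rcases hs with rfl | hs
  · exact Or.inl ⟨false, 0, fun _ _ => rfl⟩
  by_cases h : ∀ m, s ∈ closure ((fun n => shift^[n] towerSeq) '' Set.Ici m)
  · left
    by_cases hc : ∃ i, s i ≠ s (i + 1)
    · obtain ⟨i, hi⟩ := hc
      refine ⟨s (i + 1), i + 1, fun n hn => ?_⟩
      by_contra hne
      obtain ⟨t, ht, -, ht'⟩ := exists_ne_succ hn (Ne.symm hne)
      have := le_of_mem_closure_tails h hi ht'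
      omega
    · refine ⟨s 0, 0, fun n hn => ?_⟩
      by_contra hne
      obtain ⟨t, -, -, ht'⟩ := exists_ne_succ hn (Ne.symm hne)
      exact hc ⟨t, ht'⟩
  · right
    push Not at h
    obtain ⟨m, hm⟩ := h
    have hu : Set.range (fun n => shift^[n] towerSeq) =
        (fun n => shift^[n] towerSeq) '' Set.Iio m ∪ (fun n => shift^[n] towerSeq) '' Set.Ici m := by
      rw [← Set.image_union, Set.Iio_union_Ici, Set.image_univ]
    rw [hu, closure_union] at hs
    have hs' := hs.resolve_right hm
    rw [((Set.finite_Iio m).image _).isClosed.closure_eq] at hs'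
    obtain ⟨n, -, hn⟩ := hs'
    exact ⟨n, hn.symm⟩

/-- Two shifts of `towerSeq` that differ near time `k` have a jump near time `k`. -/
theorem mem_towerWindow_of_lt_dist {i j n N k : ℕ} (hk : k ≤ n)
    (hd : (1 / 2 : ℝ) ^ N < dist (shift^[k] (shift^[i] towerSeq)) (shift^[k] (shift^[j] towerSeq))) :
    k ∈ towerWindow (i + j + N) n := by
  have h1 : ¬ ∀ m < N, shift^[k] (shift^[i] towerSeq) m = shift^[k] (shift^[j] towerSeq) m :=
    fun h => hd.not_ge (dist_le_iff.2 h)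
  push Not at h1
  obtain ⟨m, hm, h2⟩ := h1
  simp only [iterate_shift] at h2
  -- Both differing entries sit at indices of `towerSeq` in `[k, k + i + j + N)`, so a jump occurs
  -- between them.
  obtain ⟨t, h3, h4, h5⟩ : ∃ t, k ≤ t ∧ t < k + (i + j + N) ∧ towerSeq t ≠ towerSeq (t + 1) := by
    rcases le_total i j with hij | hij
    · obtain ⟨t, ht⟩ := exists_ne_succ (by omega) h2
      exact ⟨t, by omega, by omega, ht.2.2⟩
    · obtain ⟨t, ht⟩ := exists_ne_succ (by omega) h2.symm
      exact ⟨t, by omega, by omega, ht.2.2⟩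
  obtain ⟨l, hl⟩ := eq_tower_of_towerSeq_ne h5
  exact mem_towerWindow (l := l) hk (by omega) (by omega)

end BinSeq

/-! ### The example: kinds of points and the DC1 pair. -/

open DistChaos BinSeq

namespace TowerTree

attribute [local instance] PiNat.metricSpace

instance : CompactSpace towerShift := isCompact_iff_compactSpace.1 isCompact_towerShift

theorem dist_le_one (a b : towerShift) : dist a b ≤ 1 := PiNat.dist_le_one _ _

/-- The shift on `towerShift`. -/
def shiftMap : towerShift → towerShift := mapsTo_shift.restrict shift towerShift towerShift

theorem coe_iterate_shiftMap (a : towerShift) (n : ℕ) :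
    (shiftMap^[n] a : ℕ → Bool) = shift^[n] a := by
  rw [shiftMap, Set.MapsTo.iterate_restrict]; rfl

theorem lipschitzWith_shiftMap : LipschitzWith 2 shiftMap :=
  LipschitzWith.of_dist_le_mul fun a b => lipschitzWith_shift.dist_le_mul (a : ℕ → Bool) b

/-- The tree with leaf space `towerShift`. -/
abbrev Tree : Type := UltraCone towerShift

noncomputable instance instMetricSpaceTree : MetricSpace Tree :=
  inferInstanceAs (MetricSpace (UltraCone towerShift))

/-- The map of the tree that extends the shift on leaves. -/
noncomputable def treeMap : Tree → Tree := UltraCone.map dist_le_one lipschitzWith_shiftMap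

theorem dist_iterate_leaf (a b : towerShift) (n : ℕ) :
    dist (treeMap^[n] (UltraCone.leaf a)) (treeMap^[n] (UltraCone.leaf b)) =
      2 * dist (shift^[n] (a : ℕ → Bool)) (shift^[n] (b : ℕ → Bool)) := by
  rw [treeMap, UltraCone.iterate_map_leaf, UltraCone.iterate_map_leaf, UltraCone.dist_leaf,
    ← coe_iterate_shiftMap, ← coe_iterate_shiftMap]
  rfl

/-- The zero sequence. -/
def zeroSeq : towerShift := ⟨fun _ => false, Or.inl rfl⟩

/-- `towerSeq` as a point of its orbit closure. -/
def towerPt : towerShift := ⟨towerSeq, Or.inr (subset_closure ⟨0, rfl⟩)⟩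

/-- The kinds of points of the tree: those that reach the root, the leaves that are shifts of
`towerSeq`, and the leaves that are eventually constant with a given value. -/
def kind : Option (Option Bool) → Tree → Prop
  | none, x => ∃ N, ∀ n ≥ N, treeMap^[n] x = UltraCone.mk ⟨zeroSeq, 1⟩
  | some none, x => ∃ (a : towerShift) (m : ℕ), x = UltraCone.leaf a ∧ a.1 = shift^[m] towerSeq
  | some (some b), x => ∃ (a : towerShift) (N : ℕ), x = UltraCone.leaf a ∧ ∀ n ≥ N, a.1 n = b

theorem exists_kind (x : Tree) : ∃ c, kind c x := by
  rcases UltraCone.eq_leaf_or_eventually_root dist_le_one lipschitzWith_shiftMap zeroSeq x with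
    ⟨a, rfl⟩ | h
  · rcases eventually_const_or_eq_iterate a.2 with ⟨b, N, h⟩ | ⟨m, h⟩
    · exact ⟨some (some b), a, N, rfl, h⟩
    · exact ⟨some none, a, m, rfl, h⟩
  · exact ⟨none, h⟩

/-- Two points of the same kind are close to each other with frequency one. -/
theorem tendsto_closeFreq_of_kind {c : Option (Option Bool)} {x y : Tree} (hx : kind c x)
    (hy : kind c y) {δ : ℝ} (hδ : 0 < δ) : Tendsto (closeFreq treeMap x y δ) atTop (𝓝 1) := by
  match c with
  | none =>
    obtain ⟨N, hN⟩ := hx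
    obtain ⟨M, hM⟩ := hy
    refine tendsto_closeFreq_of_eventually_eq (N := max N M) (fun n hn => ?_) hδ
    rw [hN n (le_of_max_le_left hn), hM n (le_of_max_le_right hn)]
  | some none =>
    obtain ⟨a, i, rfl, ha⟩ := hx
    obtain ⟨b, j, rfl, hb⟩ := hy
    -- Half of `δ`, because leaves are twice as far apart in the tree as in `K`.
    obtain ⟨N, hN⟩ := exists_pow_lt_of_lt_one (half_pos hδ) (one_half_lt_one (α := ℝ))
    refine tendsto_closeFreq_one (φ := id) tendsto_id (towerWindow (i + j + N))
      (fun n k hk hd => mem_towerWindow_of_lt_dist hk ?_) (tendsto_card_towerWindow _)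
    rw [dist_iterate_leaf, ha, hb] at hd
    linarith
  | some (some v) =>
    obtain ⟨a, N, rfl, ha⟩ := hx
    obtain ⟨b, M, rfl, hb⟩ := hy
    refine tendsto_closeFreq_of_eventually_eq (N := max N M) (fun n hn => ?_) hδ
    rw [← dist_eq_zero, dist_iterate_leaf]
    have : shift^[n] a.1 = shift^[n] b.1 := by
      ext k
      rw [iterate_shift, iterate_shift, ha _ ((le_of_max_le_left hn).trans (Nat.le_add_left _ _)),
        hb _ ((le_of_max_le_right hn).trans (Nat.le_add_left _ _))]
    rw [this, dist_self, mul_zero]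

/-- Pigeonhole on the four kinds. -/
theorem not_infinite_isDCSet (i : DCType) :
    ¬ ∃ S : Set Tree, S.Infinite ∧ IsDCSet i treeMap S := by
  rintro ⟨S, hS, hDC⟩
  choose c hc using exists_kind
  obtain ⟨x, hx, y, hy, hne, hxy⟩ :=
    hS.exists_ne_map_eq_of_mapsTo (Set.mapsTo_univ c S) Set.finite_univ
  exact not_isDCPair_of_tendsto
    (fun δ hδ => tendsto_closeFreq_of_kind (hc x) (hxy ▸ hc y) hδ) i (hDC x hx y hy hne)

theorem iterate_shift_zeroSeq (n k : ℕ) : shift^[n] zeroSeq.1 k = false := iterate_shift _ _ _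

theorem dist_iterate_of_true {k : ℕ} (h : towerSeq k = true) :
    dist (treeMap^[k] (UltraCone.leaf zeroSeq)) (treeMap^[k] (UltraCone.leaf towerPt)) = 2 := by
  have h1 : ¬ dist (shift^[k] zeroSeq.1) (shift^[k] towerPt.1) ≤ (1 / 2) ^ 1 := by
    rw [dist_le_iff]
    intro h'
    have := h' 0 one_pos
    rw [iterate_shift_zeroSeq, iterate_shift, zero_add] at this
    change false = towerSeq k at this
    rw [h] at this
    exact absurd this (by decide)
  have hne : shift^[k] zeroSeq.1 ≠ shift^[k] towerPt.1 := fun h' => h1 (by rw [h', dist_self]; positivity)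
  rw [dist_iterate_leaf]
  rw [PiNat.dist_eq_of_ne hne] at h1 ⊢
  generalize PiNat.firstDiff (shift^[k] zeroSeq.1) (shift^[k] towerPt.1) = d at h1 ⊢
  rcases d with _ | m
  · norm_num
  · exact absurd (pow_le_pow_of_le_one (a := (1 / 2 : ℝ)) (by norm_num) (by norm_num) (Nat.succ_le_succ m.zero_le)) h1

/-- Frequencies are read off at the ends of blocks: odd blocks carry the value of `zeroSeq` and give
1, even blocks carry the opposite value and give 0. -/
theorem isDC1Pair : IsDC1Pair treeMap (UltraCone.leaf zeroSeq) (UltraCone.leaf towerPt) := by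
  have htower (r : ℕ) : Tendsto (fun j => 2 ^ 2 ^ (2 * j + r)) atTop (atTop : Filter ℕ) :=
    tendsto_tower.comp (tendsto_atTop_mono (fun j => by simp only [id]; omega) tendsto_id)
  have hφ (r : ℕ) : Tendsto (fun j => (2 ^ 2 ^ (2 * j + r)) ^ 2) atTop (atTop : Filter ℕ) :=
    (tendsto_pow_atTop two_ne_zero).comp (htower r)
  refine ⟨fun δ hδ _ => ?_, 2, two_pos, ?_, ?_⟩
  · obtain ⟨N, hN⟩ := exists_pow_lt_of_lt_one (half_pos hδ) (one_half_lt_one (α := ℝ))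
    refine upperDF_eq_one (hφ 1) (tendsto_closeFreq_one (hφ 1)
      -- Exceptional are the times before the block and the last ones, whose window of length `N`
      -- runs past its end.
      (fun j => Finset.range (2 ^ 2 ^ (2 * j + 1)) ∪
        Finset.Ico ((2 ^ 2 ^ (2 * j + 1)) ^ 2 - N) ((2 ^ 2 ^ (2 * j + 1)) ^ 2 + 1))
      (fun j k hk hd => ?_) ?_)
    · rw [Finset.mem_union, Finset.mem_range, Finset.mem_Ico]
      by_contra! hc
      have h2 : k + N < (2 ^ 2 ^ (2 * j + 1)) ^ 2 := by
        by_contra! h3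
        have := hc.2 (by omega)
        omega
      rw [dist_iterate_leaf] at hd
      have h4 : dist (shift^[k] zeroSeq.1) (shift^[k] towerPt.1) ≤ (1 / 2) ^ N := by
        refine dist_le_iff.2 fun i hi => ?_
        rw [iterate_shift_zeroSeq, iterate_shift]
        change false = towerSeq (i + k)
        rw [towerSeq_eq (k := 2 * j + 1) (by omega) (by omega)]
        simp
      linarith
    · refine squeeze_zero (fun j => by positivity) (fun j => ?_)
        ((tendsto_add_div_sq (N + 1)).comp (htower 1))
      refine div_le_div_of_nonneg_right (Nat.cast_le.2 ?_) (Nat.cast_nonneg _)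
      refine (Finset.card_union_le _ _).trans ?_
      rw [Finset.card_range, Nat.card_Ico]
      simp only
      omega
  · have h : dist (UltraCone.leaf zeroSeq) (UltraCone.leaf towerPt) = 2 :=
      -- `Nat.log 2 0 = 0` is even, so `towerSeq` starts with `true`.
      dist_iterate_of_true (k := 0) (by decide)
    rw [← h]
    exact Metric.dist_le_diam_of_mem isCompact_univ.isBounded trivial trivial
  · refine lowerDF_eq_zero (hφ 0) (tendsto_closeFreq_zero
      -- The time `T ^ 2` is counted as well, but already belongs to the next block.
      (fun j => Finset.range (2 ^ 2 ^ (2 * j + 0)) ∪ {(2 ^ 2 ^ (2 * j + 0)) ^ 2})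
      (fun j k hk hd => ?_) ?_)
    · rw [Finset.mem_union, Finset.mem_range, Finset.mem_singleton]
      by_contra! hc
      refine hd.ne (dist_iterate_of_true ?_)
      rw [towerSeq_eq (k := 2 * j + 0) (by omega) (by omega)]
      simp
    · refine squeeze_zero (fun j => by positivity) (fun j => ?_)
        ((tendsto_add_div_sq 1).comp (htower 0))
      refine div_le_div_of_nonneg_right (Nat.cast_le.2 ?_) (Nat.cast_nonneg _)
      refine (Finset.card_union_le _ _).trans ?_
      rw [Finset.card_range, Finset.card_singleton]

theorem continuous_treeMap : Continuous treeMap := UltraCone.continuous_map _ _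

theorem isDendrite : IsDendrite Tree :=
  haveI : Nonempty towerShift := ⟨zeroSeq⟩
  UltraCone.isDendrite dist_le_one (countable_range_dist _)

end TowerTree

theorem mainTheorem6 (i : DistChaos.DCType) :
    ∃ (X : Type) (_ : MetricSpace X) (f : X → X),
      DistChaos.IsDendrite X ∧ Continuous f ∧
      (∃ x y : X, DistChaos.IsDCPair i f x y) ∧
      ¬ ∃ S : Set X, S.Infinite ∧ DistChaos.IsDCSet i f S :=
  ⟨TowerTree.Tree, TowerTree.instMetricSpaceTree, TowerTree.treeMap, TowerTree.isDendrite,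
    TowerTree.continuous_treeMap, ⟨_, _, TowerTree.isDC1Pair.isDCPair i⟩,
    TowerTree.not_infinite_isDCSet i⟩
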